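/- For all positive integers $r$, $s$, $n$ and every nonnegative integer $a$, the integer $$\sum_{k=1}^n k^{2a+1}\binom{2n+1}{n+k+1}^r\binom{2n+1}{n+k}^r\binom{2n}{n+k}^s$$ is divisible by the integer $\dfrac{n(n+1)}{2}\dbinom{2n+1}{n}$. -/

import Mathlib

open Finset

/-! View the summand as a product over the edges of a closed chain, an edge `u, v` carrying `(u +
v).choose (u + k)`. Contracting a vertex replaces the chain by a combination of shorter ones with
coefficients free of `k`, down to `(2 * j).choose (j + k)`, whose doubled odd moments are multiples
of `j * (2 * j).choose j`. Undoing the contractions, both end vertices `x = n` and `m = n + 1`, each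
times `(m + x).choose m`, divide twice the sum. Coprimality of `n` and `n + 1` finishes. -/

/-- A Vandermonde convolution centred at `k`. -/
theorem sum_choose_add_mul_choose_sub {x y k : ℕ} (hx : k ≤ x) :
    ∑ j ∈ range (x + 1), (y + k).choose (j + k) * (if k ≤ j then (x - k).choose (j - k) else 0) =
      (x + y).choose (x + k) := by
  obtain ⟨d, rfl⟩ := Nat.exists_eq_add_of_le hx
  have h1 : k + d + y = (y + k) + d := by ring
  rw [h1, Nat.add_choose_eq, Finset.Nat.sum_antidiagonal_eq_sum_range_succ_mk,
    show (k + d + k).succ = 2 * k + (d + 1) by omega, sum_range_add _ (2 * k),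
    add_assoc k d 1, sum_range_add _ k]
  have h2 : ∑ j ∈ range k, (y + k).choose (j + k) *
      (if k ≤ j then (k + d - k).choose (j - k) else 0) = 0 := by
    refine sum_eq_zero fun j hj => ?_
    rw [if_neg (by simpa using hj), mul_zero]
  have h3 : ∑ j ∈ range (2 * k), (y + k).choose j * d.choose (k + d + k - j) = 0 := by
    refine sum_eq_zero fun j hj => ?_
    rw [Nat.choose_eq_zero_of_lt (n := d) (by have := mem_range.1 hj; omega), mul_zero]
  rw [h2, h3]
  congr 1
  refine sum_congr rfl fun j hj => ?_
  have hj' : j ≤ d := by have := mem_range.1 hj; omega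
  rw [if_pos (by omega), show k + d - k = d by omega, show k + j - k = j by omega,
    show k + d + k - (2 * k + j) = d - j by omega, Nat.choose_symm hj',
    show k + j + k = 2 * k + j by ring]

/-- Contraction of the first two vertices `x, y` of a chain `w, x, y, z`. -/
theorem choose_mul_choose_mul_choose_eq_sum (w x y z k : ℕ) :
    (x + y).choose (x + k) * (y + z).choose (y + k) * (w + x).choose (w + k) =
      ∑ j ∈ range (x + 1), (y + z).choose (z + j) * (w + x).choose (w + j) *
        ((j + z).choose (j + k) * (w + j).choose (w + k)) := by
  by_cases hx : k ≤ x
  swap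
  · rw [Nat.choose_eq_zero_of_lt (show w + x < w + k by omega), mul_zero]
    refine (sum_eq_zero fun j hj => ?_).symm
    rw [Nat.choose_eq_zero_of_lt (show w + j < w + k by have := mem_range.1 hj; omega)]
    simp
  by_cases hz : k ≤ z
  swap
  · rw [Nat.choose_eq_zero_of_lt (show y + z < y + k by omega)]
    simp only [mul_zero, zero_mul]
    refine (sum_eq_zero fun j hj => ?_).symm
    rw [Nat.choose_eq_zero_of_lt (show j + z < j + k by omega)]
    simp
  rw [← sum_choose_add_mul_choose_sub hx, sum_mul, sum_mul]
  refine sum_congr rfl fun j hj => ?_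
  have hjx : j ≤ x := by have := mem_range.1 hj; omega
  by_cases hkj : k ≤ j
  swap
  · rw [if_neg hkj, Nat.choose_eq_zero_of_lt (show w + j < w + k by omega)]
    simp
  rw [if_pos hkj]
  have e1 : (w + x).choose (w + j) * (w + j).choose (w + k) =
      (w + x).choose (w + k) * (x - k).choose (j - k) := by
    rw [Nat.choose_mul (by omega)]
    congr 2 <;> omega
  have e2 : (y + z).choose (z + j) * (j + z).choose (j + k) =
      (y + z).choose (y + k) * (y + k).choose (j + k) := by
    by_cases hjy : j ≤ y
    swap
    · rw [Nat.choose_eq_zero_of_lt (show y + z < z + j by omega),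
        Nat.choose_eq_zero_of_lt (show y + k < j + k by omega)]
      simp
    have s1 : (j + z).choose (j + k) = (z + j).choose (z - k) := by
      rw [add_comm j z]; exact (Nat.choose_symm_of_eq_add (by omega))
    have s2 : (y + z).choose (y + k) = (y + z).choose (z - k) :=
      Nat.choose_symm_of_eq_add (by omega)
    rw [s1, s2, Nat.choose_mul (by omega)]
    congr 2 <;> omega
  calc _ = ((y + z).choose (y + k) * (y + k).choose (j + k)) *
        ((w + x).choose (w + k) * (x - k).choose (j - k)) := by ring
    _ = _ := by rw [← e1, ← e2]; ring

/-- Linearization of the product `(x + m).choose (x + k) * (m + x).choose (m + k)` in the central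
coefficients `(2 * j).choose (j + k)`. -/
theorem choose_mul_choose_eq_sum (x m k : ℕ) :
    (x + m).choose (x + k) * (m + x).choose (m + k) =
      ∑ j ∈ range (x + 1), (m + x).choose (m + j) * (m + j).choose (2 * j) *
        (2 * j).choose (j + k) := by
  by_cases hx : k ≤ x
  swap
  · rw [Nat.choose_eq_zero_of_lt (show m + x < m + k by omega), mul_zero]
    refine (sum_eq_zero fun j hj => ?_).symm
    rw [Nat.choose_eq_zero_of_lt (show 2 * j < j + k by have := mem_range.1 hj; omega), mul_zero]
  rw [← sum_choose_add_mul_choose_sub hx, sum_mul]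
  refine sum_congr rfl fun j hj => ?_
  have hjx : j ≤ x := by have := mem_range.1 hj; omega
  by_cases hkj : k ≤ j
  swap
  · rw [if_neg hkj, Nat.choose_eq_zero_of_lt (show 2 * j < j + k by omega)]
    simp
  rw [if_pos hkj]
  by_cases hjm : j ≤ m
  swap
  · rw [Nat.choose_eq_zero_of_lt (show m + k < j + k by omega),
      Nat.choose_eq_zero_of_lt (show m + j < 2 * j by omega)]
    simp
  have e1 : (m + j).choose (2 * j) * (2 * j).choose (j + k) =
      (m + j).choose (m + k) * (m + k).choose (j + k) := by
    rw [Nat.choose_mul (by omega), Nat.choose_mul (by omega),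
      show m + j - (j + k) = m - k by omega, show 2 * j - (j + k) = j - k by omega,
      show m + k - (j + k) = m - j by omega]
    congr 1
    exact Nat.choose_symm_of_eq_add (by omega)
  have e2 : (m + x).choose (m + j) * (m + j).choose (m + k) =
      (m + x).choose (m + k) * (x - k).choose (j - k) := by
    rw [Nat.choose_mul (by omega)]
    congr 2 <;> omega
  rw [mul_assoc _ ((m + j).choose (2 * j)), e1, ← mul_assoc, e2]
  ring

/-! ### Odd moments of centred binomial coefficients -/

/-- Telescoping: `2 * k = (j + k) - (j - k)`, and `j - k` is absorbed by passing to the next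
binomial coefficient. -/
theorem sum_two_mul_mul_centered_choose (j N : ℕ) :
    ∑ k ∈ Icc 1 N, 2 * (k * (2 * j).choose (j + k)) +
      (2 * j).choose (j + N + 1) * (j + N + 1) = j * (2 * j).choose j := by
  induction N with
  | zero =>
    simp only [Nat.choose_succ_right_eq]
    rw [show 2 * j - j = j by omega]
    simp [mul_comm]
  | succ N ih =>
    rw [sum_Icc_succ_top (by omega), ← ih, add_assoc]
    congr 1
    rw [Nat.choose_succ_right_eq]
    by_cases h : N + 1 ≤ j
    · obtain ⟨d, rfl⟩ := Nat.exists_eq_add_of_le h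
      rw [show 2 * (N + 1 + d) - (N + 1 + d + (N + 1)) = d by omega, ← add_assoc]
      ring
    · rw [Nat.choose_eq_zero_of_lt (show 2 * j < j + (N + 1) by omega),
        Nat.choose_eq_zero_of_lt (show 2 * j < j + N + 1 by omega)]
      simp

/-- Absorbing `(i + 1) ^ 2 - k ^ 2` lowers the centre; this trades a factor `k ^ 2` for lower
moments. -/
theorem sq_mul_centered_choose_add (i k : ℕ) :
    2 * (i + 1) * (2 * i + 1) * (2 * i).choose (i + k) +
      k ^ 2 * (2 * (i + 1)).choose (i + 1 + k) =
      (i + 1) ^ 2 * (2 * (i + 1)).choose (i + 1 + k) := by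
  by_cases h : k ≤ i + 1
  · have h1 := Nat.add_one_mul_choose_eq (2 * i) (i + k)
    have h2 := Nat.choose_mul_succ_eq (2 * i + 1) (i + k + 1)
    obtain ⟨d, hd⟩ := Nat.exists_eq_add_of_le h
    rw [show 2 * i + 1 + 1 - (i + k + 1) = d by omega] at h2
    rw [show 2 * (i + 1) = 2 * i + 1 + 1 by ring, show i + 1 + k = i + k + 1 by ring]
    calc _ = (2 * i + 1 + 1) * ((2 * i + 1) * (2 * i).choose (i + k)) +
          k ^ 2 * (2 * i + 1 + 1).choose (i + k + 1) := by ring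
      _ = (i + k + 1) * ((2 * i + 1).choose (i + k + 1) * (2 * i + 1 + 1)) +
          k ^ 2 * (2 * i + 1 + 1).choose (i + k + 1) := by rw [h1]; ring
      _ = ((i + 1 + k) * d + k ^ 2) * (2 * i + 1 + 1).choose (i + k + 1) := by rw [h2]; ring
      _ = _ := by rw [hd]; ring
  · rw [Nat.choose_eq_zero_of_lt (show 2 * i < i + k by omega),
      Nat.choose_eq_zero_of_lt (show 2 * (i + 1) < i + 1 + k by omega)]
    simp

/-- Twice the odd power moment of `f` over `1, …, N`. -/
def oddMoment (N a : ℕ) (f : ℕ → ℕ) : ℕ := ∑ k ∈ Icc 1 N, 2 * (k ^ (2 * a + 1) * f k)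

theorem oddMoment_sum (N a : ℕ) (s : Finset ℕ) (c : ℕ → ℕ) (f : ℕ → ℕ → ℕ) :
    oddMoment N a (fun k => ∑ j ∈ s, c j * f j k) = ∑ j ∈ s, c j * oddMoment N a (f j) := by
  simp only [oddMoment, mul_sum]
  rw [sum_comm]
  exact sum_congr rfl fun _ _ => sum_congr rfl fun _ _ => by ring

theorem dvd_oddMoment_centered_choose (N a j : ℕ) (hj : j ≤ N) :
    j * (2 * j).choose j ∣ oddMoment N a fun k => (2 * j).choose (j + k) := by
  induction a generalizing j with
  | zero =>
    have h := sum_two_mul_mul_centered_choose j N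
    rw [Nat.choose_eq_zero_of_lt (by omega : 2 * j < j + N + 1), zero_mul, add_zero] at h
    simp [oddMoment, h]
  | succ a ih =>
    cases j with
    | zero =>
      have : oddMoment N (a + 1) (fun k => (2 * 0).choose (0 + k)) = 0 := by
        refine sum_eq_zero fun k hk => ?_
        have hk0 : 0 < 0 + k := by have := mem_Icc.1 hk; omega
        simp only [Nat.choose_eq_zero_of_lt hk0, mul_zero]
      rw [this]
      exact dvd_zero _
    | succ i =>
      have key : 2 * (i + 1) * (2 * i + 1) * oddMoment N a (fun k => (2 * i).choose (i + k)) +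
          oddMoment N (a + 1) (fun k => (2 * (i + 1)).choose (i + 1 + k)) =
          (i + 1) ^ 2 * oddMoment N a (fun k => (2 * (i + 1)).choose (i + 1 + k)) := by
        simp only [oddMoment, mul_sum, ← sum_add_distrib]
        refine sum_congr rfl fun k _ => ?_
        linear_combination (2 * k ^ (2 * a + 1)) * sq_mul_centered_choose_add i k
      -- The recurrence at `k = 0`, times `i`.
      have hc : (i + 1) * (2 * (i + 1)).choose (i + 1) ∣
          2 * (i + 1) * (2 * i + 1) * (i * (2 * i).choose i) := by
        have h := sq_mul_centered_choose_add i 0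
        simp only [add_zero] at h
        refine ⟨i * (i + 1), ?_⟩
        linear_combination i * h
      refine (Nat.dvd_add_right (hc.trans (mul_dvd_mul_left _ (ih i (by omega))))).1 ?_
      rw [key]
      exact (ih (i + 1) hj).mul_left _

/-! ### Divisibility along closed chains -/

/-- The divisibility satisfied by all cyclic products of binomial coefficients along
`x, n, …, m, x`, where `g` is the product along the inner part `n, …, m`. -/
def ChainDvd (N a n m : ℕ) (g : ℕ → ℕ) : Prop :=
  ∀ x ≤ N, x * (m + x).choose m ∣
      oddMoment N a (fun k => (x + n).choose (x + k) * g k * (m + x).choose (m + k)) ∧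
    m * (m + x).choose m ∣
      oddMoment N a (fun k => (x + n).choose (x + k) * g k * (m + x).choose (m + k))

theorem mul_choose_dvd_mul_choose (x j : ℕ) : x ∣ j * x.choose j := by
  cases j with
  | zero => simp
  | succ j =>
    cases x with
    | zero => simp
    | succ x => exact ⟨_, by rw [Nat.add_one_mul_choose_eq, mul_comm]⟩

theorem choose_add_mul_choose (m x j : ℕ) :
    (m + x).choose (m + j) * (m + j).choose m = (m + x).choose m * x.choose j := by
  by_cases h : j ≤ x
  · rw [Nat.choose_mul (by omega)]
    congr 2 <;> omega
  · rw [Nat.choose_eq_zero_of_lt (show m + x < m + j by omega),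
      Nat.choose_eq_zero_of_lt (show x < j by omega)]
    simp

theorem ChainDvd.base (N a m : ℕ) : ChainDvd N a m m fun _ => 1 := by
  intro x hx
  have e : (fun k => (x + m).choose (x + k) * 1 * (m + x).choose (m + k)) = fun k =>
      ∑ j ∈ range (x + 1), (m + x).choose (m + j) * (m + j).choose (2 * j) *
        (2 * j).choose (j + k) := by
    funext k
    rw [mul_one, choose_mul_choose_eq_sum]
  have hmul (j : ℕ) : (m + x).choose (m + j) * (m + j).choose (2 * j) * (2 * j).choose j =
      (m + x).choose m * x.choose j * m.choose j := by
    by_cases hj : j ≤ m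
    · rw [← choose_add_mul_choose, mul_assoc, mul_assoc, Nat.choose_mul (by omega),
        show m + j - j = m by omega, show 2 * j - j = j by omega,
        Nat.choose_symm_add]
    · rw [Nat.choose_eq_zero_of_lt (show m + j < 2 * j by omega),
        Nat.choose_eq_zero_of_lt (show m < j by omega)]
      simp
  have hd (j : ℕ) (hj : j ∈ range (x + 1)) :
      (m + x).choose m * (j * x.choose j * m.choose j) ∣
        (m + x).choose (m + j) * (m + j).choose (2 * j) *
          oddMoment N a (fun k => (2 * j).choose (j + k)) := by
    have h := mul_dvd_mul_left ((m + x).choose (m + j) * (m + j).choose (2 * j))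
      (dvd_oddMoment_centered_choose N a j (by have := mem_range.1 hj; omega))
    rwa [mul_left_comm, hmul, mul_assoc, mul_left_comm j, ← mul_assoc j] at h
  rw [e, oddMoment_sum]
  constructor <;> refine dvd_sum fun j hj => dvd_trans ?_ (hd j hj)
  · rw [mul_comm]
    exact mul_dvd_mul_left _ ((mul_choose_dvd_mul_choose x j).mul_right _)
  · rw [mul_comm, mul_right_comm]
    exact mul_dvd_mul_left _ ((mul_choose_dvd_mul_choose m j).mul_right _)

/-- Contracting `x, y` into `j ≤ x` leaves the old chain closed at `j`, which is why `ChainDvd`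
quantifies over all `x ≤ N`. The coefficient `(m + x).choose (m + j)` turns `(m + j).choose m` into
`(m + x).choose m * x.choose j`, and `x ∣ j * x.choose j`. -/
theorem ChainDvd.cons {N a n m : ℕ} {g : ℕ → ℕ} (h : ChainDvd N a n m g) (y : ℕ) :
    ChainDvd N a y m fun k => (y + n).choose (y + k) * g k := by
  intro x hx
  have e : (fun k => (x + y).choose (x + k) * ((y + n).choose (y + k) * g k) *
        (m + x).choose (m + k)) = fun k =>
      ∑ j ∈ range (x + 1), (y + n).choose (n + j) * (m + x).choose (m + j) *
        ((j + n).choose (j + k) * g k * (m + j).choose (m + k)) := by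
    funext k
    calc _ = (x + y).choose (x + k) * (y + n).choose (y + k) * (m + x).choose (m + k) * g k := by
          ring
      _ = _ := by
        rw [choose_mul_choose_mul_choose_eq_sum, sum_mul]
        exact sum_congr rfl fun j _ => by ring
  rw [e, oddMoment_sum]
  constructor <;> refine dvd_sum fun j hj => ?_
  · have hj' := mul_dvd_mul_left ((m + x).choose (m + j))
      (h j (by have := mem_range.1 hj; omega)).1
    rw [mul_assoc]
    refine (dvd_trans ?_ hj').mul_left _
    rw [mul_left_comm, choose_add_mul_choose, mul_left_comm, mul_comm]
    exact mul_dvd_mul_left _ (mul_choose_dvd_mul_choose x j)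
  · have hj' := mul_dvd_mul_left ((m + x).choose (m + j))
      (h j (by have := mem_range.1 hj; omega)).2
    rw [mul_assoc]
    refine (dvd_trans ?_ hj').mul_left _
    rw [mul_left_comm, choose_add_mul_choose]
    exact mul_dvd_mul_left _ (dvd_mul_right _ _)

theorem ChainDvd.pair_pow (N a n r : ℕ) : ChainDvd N a (n + 1) (n + 1) fun k =>
    ((n + 1 + n).choose (n + 1 + k) * (n + (n + 1)).choose (n + k)) ^ r := by
  induction r with
  | zero => simpa using ChainDvd.base N a (n + 1)
  | succ r ih =>
    convert (ih.cons n).cons (n + 1) using 2 with k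
    ring

theorem ChainDvd.self_pow {N a n m : ℕ} {g : ℕ → ℕ} (h : ChainDvd N a n m g) (s : ℕ) :
    ChainDvd N a n m fun k => (n + n).choose (n + k) ^ s * g k := by
  induction s with
  | zero => simpa using h
  | succ s ih =>
    convert ih.cons n using 2 with k
    ring

theorem corollary6p3 (r s n a : ℕ) (hr : 0 < r) (hs : 0 < s) (hn : 0 < n) :
    (n * (n + 1) / 2) * (2 * n + 1).choose n ∣
      ∑ k ∈ Finset.Icc 1 n,
        k ^ (2 * a + 1) * (2 * n + 1).choose (n + k + 1) ^ r *
          (2 * n + 1).choose (n + k) ^ r * (2 * n).choose (n + k) ^ s := by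
  obtain ⟨r, rfl⟩ := Nat.exists_eq_add_one.2 hr
  obtain ⟨s, rfl⟩ := Nat.exists_eq_add_one.2 hs
  -- Closing the chain at `x = n` supplies the last `n, n` edge and the edge `n + 1, n`; hence the
  -- inner exponents `r` and `s` after the shift.
  obtain ⟨h1, h2⟩ := ((ChainDvd.pair_pow n a n r).cons n).self_pow s n le_rfl
  set S := ∑ k ∈ Finset.Icc 1 n,
        k ^ (2 * a + 1) * (2 * n + 1).choose (n + k + 1) ^ (r + 1) *
          (2 * n + 1).choose (n + k) ^ (r + 1) * (2 * n).choose (n + k) ^ (s + 1) with hS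
  have hM : oddMoment n a (fun k => (n + n).choose (n + k) * ((n + n).choose (n + k) ^ s *
      ((n + (n + 1)).choose (n + k) * ((n + 1 + n).choose (n + 1 + k) *
        (n + (n + 1)).choose (n + k)) ^ r)) * (n + 1 + n).choose (n + 1 + k)) = 2 * S := by
    rw [hS, oddMoment, mul_sum]
    refine sum_congr rfl fun k _ => ?_
    rw [show n + n = 2 * n by ring, show n + (n + 1) = 2 * n + 1 by ring,
      show n + 1 + n = 2 * n + 1 by ring, show n + 1 + k = n + k + 1 by ring]
    ring
  have hC : (n + 1 + n).choose (n + 1) = (2 * n + 1).choose n := by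
    rw [show n + 1 + n = 2 * n + 1 by ring]
    exact Nat.choose_symm_of_eq_add (by omega)
  rw [hM, hC] at h1 h2
  obtain ⟨t, ht⟩ := (Nat.even_mul_succ_self n).two_dvd
  have hpos : 0 < (2 * n + 1).choose n := Nat.choose_pos (by omega)
  obtain ⟨q, hq⟩ := (dvd_mul_left _ n).trans h1
  rw [hq, mul_comm, Nat.mul_dvd_mul_iff_left hpos] at h1 h2
  have h3 : n * (n + 1) ∣ q := Nat.Coprime.mul_dvd_of_dvd_of_dvd (by simp) h1 h2
  rw [ht, Nat.mul_div_cancel_left _ two_pos]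
  rw [ht] at h3
  refine Nat.dvd_of_mul_dvd_mul_left two_pos ?_
  rw [hq, ← mul_assoc, mul_comm]
  exact mul_dvd_mul_left _ h3
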